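/- Consider a $K$ user ADT deterministic interference network with $M$ parallel sub-channels and strengths $n_{ki}^{[m]}\in\{0,1,2,\dots\}$. On sub-channel $m$, Transmitter $i$ sends $X_i^{[m]}=0.X_{i,(1)}^{[m]}X_{i,(2)}^{[m]}X_{i,(3)}^{[m]}\ldots$ (in base 2) and Receiver $k$ observes $$Y_k^{[m]}=\lfloor 2^{n_{k1}^{[m]}}X_1^{[m]}\rfloor\oplus\cdots\oplus\lfloor 2^{n_{kK}^{[m]}}X_K^{[m]}\rfloor ,$$ with $\oplus$ the bitwise addition modulo two. Independent messages $W_i$, uniform on $\{1,\dots,\lceil 2^{TR_i}\rceil\}$, are encoded jointly over $T$ channel uses and all sub-channels, and Receiver $k$ estimates $W_k$ from its outputs in all channel uses and sub-channels. The rate tuple $(R_1,\dots,R_K)$, $R_i\ge 0$, is achievable if there are codes for which the error probability of each receiver tends to $0$ as $T\to\infty$. The capacity region is the closure of the set of achievable tuples, and the sum-capacity is the maximum of $\sum_k R_k$ over it. Suppose that each sub-channel $m$ (i) is TIN optimal: $n_{ii}^{[m]}\ge\max_{j\ne i}n_{ji}^{[m]}+\max_{k\neq i}n_{ik}^{[m]}$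 for all users $i$; and (ii) is a cyclic interference network: there is a cyclically ordered subset of the users (possibly different for different $m$) such that each user in it causes interference at most to its predecessor in the cyclic order, and users outside of it neither cause nor suffer interference, i.e. if $i\ne j$ and $n_{ij}^{[m]}\neq 0$, then $i$ and $j$ belong to the subset and $i$ is the predecessor of $j$. Then the sum-capacity is achieved by separate power control and treating interference as noise (TIN) on each sub-channel. That is, there are integers $p_i^{[m]}\ge 0$ with the following property. On sub-channel $m$, let the inputs $X_1^{[m]},\dots,X_K^{[m]}$ be independent, where the first $p_i^{[m]}$ bits of $X_i^{[m]}$ are zero and its further bits, up to the last one that is heard by some receiver, are independent and uniform, and let $R_k^{[m]}=I(X_k^{[m]};Y_k^{[m]})$ be the resulting TIN rates in bits. Then, for each $m$, $(R_1^{[m]},\dots,R_K^{[m]})$ belongs to the capacity region of sub-channel $m$ alone and $\sum_k R_k^{[m]}$ is its sum-capacity; and the tuple $\big(\sum_m R_1^{[m]},\dots,\sum_m R_K^{[m]}\big)$ belongs to the capacity region of the parallel network and its sum $\sum_k\sum_m R_k^{[m]}$ is the sum-capacity of the parallel network. -/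

import Mathlib

open Finset Filter Topology

namespace ADT

/-- A channel input `0.x₍₁₎x₍₂₎x₍₃₎…` given by its bits: `x b` is the `(b+1)`-th bit after the binary
point. The same type is used for the outputs (nonnegative integers in base 2), where `y l` is the
coefficient of `2 ^ l`. Addition in `ZMod 2` is the bitwise modulo-two addition. -/
abbrev Signal : Type := ℕ → ZMod 2

/-- The strengths `n k i` (from Transmitter `i` to Receiver `k`) of one sub-channel with `K` users. -/
abbrev Strengths (K : ℕ) : Type := Fin K → Fin K → ℕ

/-- `⌊2 ^ s * x⌋`: its coefficient of `2 ^ l` is the `(s - l)`-th bit of `x` for `l < s`,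
and `0` otherwise. -/
def shiftFloor (s : ℕ) (x : Signal) : Signal :=
  fun l => if l < s then x (s - 1 - l) else 0

/-- The signal at Receiver `k`: `⌊2 ^ (n k 1) * x 1⌋ ⊕ ⋯ ⊕ ⌊2 ^ (n k K) * x K⌋`. -/
def output {K : ℕ} (n : Strengths K) (x : Fin K → Signal) (k : Fin K) : Signal :=
  ∑ i, shiftFloor (n k i) (x i)

/-- The number `⌈2 ^ (T * R)⌉` of messages for rate `R` and `T` channel uses. -/
noncomputable def numMsg (T : ℕ) (R : ℝ) : ℕ := ⌈(2 : ℝ) ^ ((T : ℝ) * R)⌉₊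

/-- A code for `M` parallel sub-channels over `T` channel uses: Transmitter `i` maps its message to
one input per channel use and sub-channel, and Receiver `k` estimates its message from its outputs
in all channel uses and sub-channels. -/
structure Code (K M T : ℕ) (R : Fin K → ℝ) where
  enc : (i : Fin K) → Fin (numMsg T (R i)) → Fin T → Fin M → Signal
  dec : (k : Fin K) → (Fin T → Fin M → Signal) → Fin (numMsg T (R k))

/-- The signals observed by Receiver `k` when the messages `w` are sent. -/
def Code.observed {K M T : ℕ} {R : Fin K → ℝ} (c : Code K M T R) (n : Fin M → Strengths K)
    (w : (i : Fin K) → Fin (numMsg T (R i))) (k : Fin K) : Fin T → Fin M → Signal :=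
  fun t m => output (n m) (fun i => c.enc i (w i) t m) k

open Classical in
/-- The probability that Receiver `k` errs, for independent uniformly distributed messages. -/
noncomputable def Code.errorProb {K M T : ℕ} {R : Fin K → ℝ} (c : Code K M T R)
    (n : Fin M → Strengths K) (k : Fin K) : ℝ :=
  (#{w : (i : Fin K) → Fin (numMsg T (R i)) | c.dec k (c.observed n w k) ≠ w k} : ℝ) /
    (Fintype.card ((i : Fin K) → Fin (numMsg T (R i))) : ℝ)

/-- The rate tuple `R` is achievable: there are codes of these rates, one for each number of channel
uses, for which the error probability of each receiver tends to zero. -/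
def Achievable {K M : ℕ} (n : Fin M → Strengths K) (R : Fin K → ℝ) : Prop :=
  (∀ i, 0 ≤ R i) ∧
    ∃ c : (T : ℕ) → Code K M T R, ∀ k, Tendsto (fun T => (c T).errorProb n k) atTop (𝓝 0)

/-- The capacity region: the closure of the set of achievable rate tuples. -/
def capacityRegion {K M : ℕ} (n : Fin M → Strengths K) : Set (Fin K → ℝ) :=
  closure {R | Achievable n R}

/-- `C` is the sum-capacity: the maximum of the sum-rate over the capacity region. -/
def IsSumCapacity {K M : ℕ} (n : Fin M → Strengths K) (C : ℝ) : Prop :=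
  IsGreatest ((fun R : Fin K → ℝ => ∑ i, R i) '' capacityRegion n) C

/-- A sub-channel on its own, as a network with a single sub-channel. -/
def single {K : ℕ} (n : Strengths K) : Fin 1 → Strengths K := fun _ => n

/-- The TIN optimality condition:
`n i i ≥ max_{j ≠ i} n j i + max_{k ≠ i} n i k` for every user `i`. -/
def TINOptimal {K : ℕ} (n : Strengths K) : Prop :=
  ∀ i j k : Fin K, j ≠ i → k ≠ i → n j i + n i k ≤ n i i

/-- A cyclic interference network: for some cyclically ordered subset `S` of the users, in which
`π j` is the predecessor of `j`, each user causes interference at most to its predecessor in the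
cycle; users outside the cycle neither cause nor suffer interference. -/
def IsCyclic {K : ℕ} (n : Strengths K) : Prop :=
  ∃ (S : Set (Fin K)) (π : Equiv.Perm (Fin K)), π.IsCycleOn S ∧
    ∀ i j : Fin K, i ≠ j → n i j ≠ 0 → j ∈ S ∧ i = π j

open Classical in
/-- The Shannon entropy in bits of a random variable `X` on a finite uniform probability space. -/
noncomputable def entropy {Ω α : Type} [Fintype Ω] (X : Ω → α) : ℝ :=
  ∑ x ∈ univ.image X,
    Real.negMulLog ((#{ω : Ω | X ω = x} : ℝ) / (Fintype.card Ω : ℝ)) / Real.log 2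

/-- The mutual information `I(X; Y) = H(X) + H(Y) - H(X, Y)` in bits. -/
noncomputable def mutualInfo {Ω α β : Type} [Fintype Ω] (X : Ω → α) (Y : Ω → β) : ℝ :=
  entropy X + entropy Y - entropy (fun ω => (X ω, Y ω))

/-- The largest strength in a sub-channel. Input bits beyond it are heard by no receiver. -/
def maxLevel {K : ℕ} (n : Strengths K) : ℕ := univ.sup fun k => univ.sup fun i => n k i

/-- The input with peak amplitude scaled by `2 ^ (-p)`: the first `p` bits vanish, and the remaining ones (up to the
last bit heard by some receiver) are taken from `b`. For independent fair bits `b` it is uniformly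
distributed over the levels that the power control leaves to the transmitter. -/
def powerControlled {q : ℕ} (p : ℕ) (b : Fin q → ZMod 2) : Signal :=
  fun l => if h : l < q then (if p ≤ l then b ⟨l, h⟩ else 0) else 0

/-- The rate `I(X_k; Y_k)` that user `k` obtains in one sub-channel by power control and treating
interference as noise: the inputs `X_i` are independent, `X_i` is uniform over the levels left to
Transmitter `i` by its back-off `p i`, and `Y_k` is the signal at Receiver `k`. -/
noncomputable def tinRate {K : ℕ} (n : Strengths K) (p : Fin K → ℕ) (k : Fin K) : ℝ :=
  mutualInfo (fun b : Fin K → Fin (maxLevel n) → ZMod 2 => powerControlled (p k) (b k))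
    (fun b : Fin K → Fin (maxLevel n) → ZMod 2 =>
      output n (fun i => powerControlled (p i) (b i)) k)

end ADT

/-! Let every transmitter back off by the strength of the strongest interference it causes. All
interference then becomes inaudible, and on each sub-channel user `k` gets `privateLevels` bits per
channel use without coding.

For the converse, let S_ki be the interference of Transmitter i at Receiver k, over all channel uses
and sub-channels jointly. In a cyclic network a receiver has at most one interferer per sub-channel,
so W_k and Y_k reveal every S_ki; these are independent of each other and of W_k, whence H(W_k, Y_k)
≥ H(W_k) + ∑_i H(S_ki) (`Code.log_add_natEntropy_interference_le`). By TIN optimality, Y_k is a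
function of its private levels and of the S_ik that user k causes, so with Fano H(W_k, Y_k) is at
most ∑_i H(S_ik), plus the number of private bits, plus the Fano terms
(`Code.natEntropy_observed_le`). Summed over k, the interference entropies cancel
(`Code.sum_rate_mul_le`). They are never split by sub-channel, so coding across sub-channels is
covered. -/

namespace ADT

/-! ### Entropy on finite uniform probability spaces. -/

section NatEntropy

variable {Ω α β : Type} [Fintype Ω]

open Classical in
/-- The probability of `X = x` on a finite uniform probability space. -/
noncomputable def prob (X : Ω → α) (x : α) : ℝ :=
  (#{ω : Ω | X ω = x} : ℝ) / (Fintype.card Ω : ℝ)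

/-- The Shannon entropy in nats, as the mean of the information content. -/
noncomputable def natEntropy (X : Ω → α) : ℝ :=
  (∑ ω, -Real.log (prob X (X ω))) / (Fintype.card Ω : ℝ)

theorem prob_nonneg (X : Ω → α) (x : α) : 0 ≤ prob X x := by
  unfold prob; positivity

theorem prob_apply_pos (X : Ω → α) (ω : Ω) : 0 < prob X (X ω) := by
  classical
  unfold prob
  have h1 : 0 < #{ω' : Ω | X ω' = X ω} := card_pos.2 ⟨ω, by simp⟩
  have h2 : 0 < Fintype.card Ω := Fintype.card_pos_iff.2 ⟨ω⟩
  positivity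

theorem sum_prob_image [Nonempty Ω] [DecidableEq α] (X : Ω → α) :
    ∑ x ∈ univ.image X, prob X x = 1 := by
  classical
  unfold prob
  rw [← Finset.sum_div, div_eq_one_iff_eq (by simp)]
  norm_cast
  rw [← Finset.card_univ, Finset.card_eq_sum_card_image X univ]
  refine Finset.sum_congr rfl fun x _ => ?_
  congr!

theorem entropy_eq_natEntropy_div (X : Ω → α) : entropy X = natEntropy X / Real.log 2 := by
  classical
  unfold entropy natEntropy
  have h : ∑ ω, -Real.log (prob X (X ω)) =
      ∑ x ∈ univ.image X, (#{ω : Ω | X ω = x}) • -Real.log (prob X x) :=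
    Finset.sum_comp (fun x => -Real.log (prob X x)) X
  rw [h, Finset.sum_div, Finset.sum_div]
  refine Finset.sum_congr rfl fun x _ => ?_
  rw [Real.negMulLog, nsmul_eq_mul]
  unfold prob
  ring

theorem natEntropy_eq_log_of_prob_eq [Nonempty Ω] (X : Ω → α) {c : ℝ}
    (h : ∀ ω, prob X (X ω) = c⁻¹) : natEntropy X = Real.log c := by
  unfold natEntropy
  simp only [h, Real.log_inv, neg_neg, sum_const, card_univ, nsmul_eq_mul]
  field_simp

theorem prob_le_prob (X : Ω → α) (Y : Ω → β) (ω : Ω)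
    (h : ∀ ω', Y ω' = Y ω → X ω' = X ω) : prob Y (Y ω) ≤ prob X (X ω) := by
  classical
  unfold prob
  gcongr with ω'
  exact h ω'

/-- When `Y` determines `X`, each fibre of `Y` lies in a fibre of `X`, so the information content is
larger at every point. -/
theorem natEntropy_mono (X : Ω → α) (Y : Ω → β)
    (h : ∀ ω ω', Y ω = Y ω' → X ω = X ω') : natEntropy X ≤ natEntropy Y := by
  unfold natEntropy
  gcongr with ω
  · exact prob_apply_pos Y ω
  · exact prob_le_prob X Y ω fun ω' => h ω' ω

theorem natEntropy_congr (X : Ω → α) (Y : Ω → β)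
    (h : ∀ ω ω', X ω = X ω' ↔ Y ω = Y ω') : natEntropy X = natEntropy Y :=
  (natEntropy_mono X Y fun ω ω' => (h ω ω').2).antisymm
    (natEntropy_mono Y X fun ω ω' => (h ω ω').1)

/-- Gibbs' inequality: the entropy is at most the cross-entropy with a subprobability `q`. -/
theorem natEntropy_le_of_sum_le_one [Nonempty Ω] (X : Ω → α) (q : α → ℝ) (s : Finset α)
    (hs : ∀ ω, X ω ∈ s) (hq : ∀ x ∈ s, 0 ≤ q x) (hpos : ∀ ω, 0 < q (X ω))
    (hsum : ∑ x ∈ s, q x ≤ 1) :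
    natEntropy X ≤ (∑ ω, -Real.log (q (X ω))) / (Fintype.card Ω : ℝ) := by
  classical
  unfold natEntropy
  gcongr ?_ / _
  have hN : (0 : ℝ) < Fintype.card Ω := by exact_mod_cast Fintype.card_pos
  -- This is log t ≤ t - 1 at t = q / prob.
  have h1 : ∀ ω, -Real.log (prob X (X ω)) - -Real.log (q (X ω)) ≤
      q (X ω) / prob X (X ω) - 1 := by
    intro ω
    have := Real.log_le_sub_one_of_pos (div_pos (hpos ω) (prob_apply_pos X ω))
    rw [Real.log_div (hpos ω).ne' (prob_apply_pos X ω).ne'] at this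
    linarith
  -- On the fibre over `x` the summand is constant, and the size of a nonempty fibre divided by
  -- `prob X x` is the size of the space.
  have h2 : ∑ ω, q (X ω) / prob X (X ω) ≤ Fintype.card Ω := by
    rw [← Finset.sum_fiberwise_of_maps_to (s := univ) (t := s) (g := X) fun ω _ => hs ω]
    calc _ ≤ ∑ x ∈ s, (Fintype.card Ω : ℝ) * q x := by
            refine Finset.sum_le_sum fun x hx => ?_
            have : ∑ ω ∈ univ with X ω = x, q (X ω) / prob X (X ω) =
                ∑ ω ∈ univ with X ω = x, q x / prob X x :=
              Finset.sum_congr rfl fun ω hω => by rw [(mem_filter.1 hω).2]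
            rw [this, Finset.sum_const, nsmul_eq_mul]
            unfold prob
            by_cases hc : (#{ω : Ω | X ω = x} : ℝ) = 0
            · rw [hc, zero_mul]; exact mul_nonneg hN.le (hq x hx)
            · apply le_of_eq; field_simp
      _ = Fintype.card Ω * ∑ x ∈ s, q x := by rw [Finset.mul_sum]
      _ ≤ Fintype.card Ω := mul_le_of_le_one_right hN.le hsum
  have h3 := Finset.sum_le_sum fun ω (_ : ω ∈ univ) => h1 ω
  rw [Finset.sum_sub_distrib, Finset.sum_sub_distrib] at h3
  simp only [sum_const, card_univ, nsmul_eq_mul, mul_one] at h3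
  linarith

theorem natEntropy_le_log_card [Nonempty Ω] [Fintype α] (X : Ω → α) :
    natEntropy X ≤ Real.log (Fintype.card α) := by
  have : Nonempty α := Nonempty.map X inferInstance
  have h := natEntropy_le_of_sum_le_one X (fun _ => (Fintype.card α : ℝ)⁻¹) univ (by simp)
    (fun _ _ => by positivity) (fun _ => by positivity) (by simp)
  refine h.trans_eq ?_
  simp only [Real.log_inv, neg_neg, sum_const, card_univ, nsmul_eq_mul]
  field_simp

/-- Gibbs' inequality with the product of the marginals as `q`. -/
theorem natEntropy_pi_le [Nonempty Ω] {ι : Type} [Fintype ι] {γ : ι → Type}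
    (X : (i : ι) → Ω → γ i) :
    natEntropy (fun ω i => X i ω) ≤ ∑ i, natEntropy (X i) := by
  classical
  have h := natEntropy_le_of_sum_le_one (fun ω i => X i ω) (fun x => ∏ i, prob (X i) (x i))
    (Fintype.piFinset fun i => univ.image (X i)) (by simp)
    (fun _ _ => Finset.prod_nonneg fun i _ => prob_nonneg _ _)
    (fun ω => Finset.prod_pos fun i _ => prob_apply_pos _ ω)
    (by rw [← Finset.prod_univ_sum]; simp [sum_prob_image])
  refine h.trans_eq ?_
  unfold natEntropy
  rw [← Finset.sum_div, Finset.sum_comm]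
  congr 1
  refine Finset.sum_congr rfl fun ω _ => ?_
  rw [Real.log_prod fun i _ => (prob_apply_pos (X i) ω).ne', Finset.sum_neg_distrib]

theorem natEntropy_prod_le [Nonempty Ω] (X : Ω → α) (Y : Ω → β) :
    natEntropy (fun ω => (X ω, Y ω)) ≤ natEntropy X + natEntropy Y := by
  classical
  have h := natEntropy_le_of_sum_le_one (fun ω => (X ω, Y ω)) (fun x => prob X x.1 * prob Y x.2)
    (univ.image X ×ˢ univ.image Y) (by simp)
    (fun _ _ => mul_nonneg (prob_nonneg _ _) (prob_nonneg _ _))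
    (fun ω => mul_pos (prob_apply_pos _ ω) (prob_apply_pos _ ω))
    (by rw [Finset.sum_product]; simp only [← Finset.mul_sum]; simp [sum_prob_image])
  refine h.trans_eq ?_
  unfold natEntropy
  rw [← add_div, ← Finset.sum_add_distrib]
  congr 1
  refine Finset.sum_congr rfl fun ω _ => ?_
  rw [Real.log_mul (prob_apply_pos X ω).ne' (prob_apply_pos Y ω).ne', neg_add]

open Classical in
/-- Fano's inequality. -/
theorem natEntropy_prod_le_of_estimate [Nonempty Ω] [Fintype α] (W : Ω → α) (Z : Ω → β)
    (g : β → α) :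
    natEntropy (fun ω => (W ω, Z ω)) ≤ natEntropy Z + Real.log 2 +
      (#{ω : Ω | g (Z ω) ≠ W ω} : ℝ) / (Fintype.card Ω : ℝ) * Real.log (Fintype.card α) := by
  have : Nonempty α := Nonempty.map W inferInstance
  have hA : (0 : ℝ) < Fintype.card α := by exact_mod_cast Fintype.card_pos
  -- A surrogate conditional law of `W` given `Z`: mass 1/2 on the estimate, the other half spread
  -- evenly over the alphabet. Its information content is log 2, plus log |α| exactly when the
  -- estimate is wrong.
  set r : α → β → ℝ := fun w z => if g z = w then 2⁻¹ else (2 * (Fintype.card α : ℝ))⁻¹ with hr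
  have hrpos : ∀ w z, 0 < r w z := fun w z => by
    simp only [hr]; split_ifs <;> positivity
  have hrsum : ∀ z, ∑ w, r w z ≤ 1 := fun z => by
    have : ∀ w, r w z ≤ (if g z = w then 2⁻¹ else 0) + (2 * (Fintype.card α : ℝ))⁻¹ := fun w => by
      simp only [hr]; split_ifs
      · have : 0 < (2 * (Fintype.card α : ℝ))⁻¹ := by positivity
        linarith
      · simp
    refine (Finset.sum_le_sum fun w _ => this w).trans (le_of_eq ?_)
    rw [Finset.sum_add_distrib, Finset.sum_ite_eq, if_pos (mem_univ _)]
    simp only [sum_const, card_univ, nsmul_eq_mul]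
    field_simp
    norm_num
  have h := natEntropy_le_of_sum_le_one (fun ω => (W ω, Z ω)) (fun x => r x.1 x.2 * prob Z x.2)
    (univ ×ˢ univ.image Z) (by simp)
    (fun _ _ => mul_nonneg (hrpos _ _).le (prob_nonneg _ _))
    (fun ω => mul_pos (hrpos _ _) (prob_apply_pos _ ω))
    (by
      rw [Finset.sum_product_right, ← sum_prob_image Z]
      refine Finset.sum_le_sum fun z _ => ?_
      simp only [← Finset.sum_mul]
      exact mul_le_of_le_one_left (prob_nonneg _ _) (hrsum z))
  refine h.trans_eq ?_
  have h1 : ∀ ω, -Real.log (r (W ω) (Z ω) * prob Z (Z ω)) = -Real.log (prob Z (Z ω)) +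
      Real.log 2 + (if g (Z ω) ≠ W ω then Real.log (Fintype.card α) else 0) := by
    intro ω
    rw [Real.log_mul (hrpos _ _).ne' (prob_apply_pos Z ω).ne']
    simp only [hr]
    by_cases hg : g (Z ω) = W ω
    · simp [hg]
    · simp only [hg, if_false, ne_eq, not_false_eq_true, if_true]
      rw [Real.log_inv, Real.log_mul two_ne_zero hA.ne']
      ring
  simp only [h1]
  rw [Finset.sum_add_distrib, Finset.sum_add_distrib, ← Finset.sum_filter]
  unfold natEntropy
  simp only [sum_const, card_univ, nsmul_eq_mul]
  field_simp

theorem natEntropy_const [Nonempty Ω] (X : Ω → α) (h : ∀ ω ω', X ω = X ω') :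
    natEntropy X = 0 := by
  have : ∀ ω, prob X (X ω) = (1 : ℝ)⁻¹ := fun ω => by simp [prob, fun ω' => h ω' ω]
  simpa using natEntropy_eq_log_of_prob_eq X this

/-- The fibres are cosets of the kernel, so the image is uniformly distributed. -/
theorem natEntropy_of_additive {A B : Type} [AddGroup A] [AddGroup B] [Fintype A] [Fintype B]
    (f : A →+ B) (hf : Function.Surjective f) :
    natEntropy f = Real.log (Fintype.card B) := by
  classical
  refine natEntropy_eq_log_of_prob_eq f fun ω => ?_
  have h : ∀ b : B, #{a : A | f a = b} = #{a : A | f a = f ω} := fun b => by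
    convert AddMonoidHom.card_fiber_eq_of_mem_range f (hf b) (hf (f ω))
  have h2 : Fintype.card A = Fintype.card B * #{a : A | f a = f ω} := by
    rw [← Finset.card_univ,
      Finset.card_eq_sum_card_fiberwise (f := f) (s := univ) (t := univ) (by simp)]
    simp [h]
  have h3 : 0 < #{a : A | f a = f ω} := card_pos.2 ⟨ω, by simp⟩
  unfold prob
  rw [h2]
  push_cast
  have : (Fintype.card B : ℝ) ≠ 0 := by simp
  field_simp

end NatEntropy

/-! ### Independence of the coordinates on a product space. -/

section Independence

variable {ι : Type} [Fintype ι] [DecidableEq ι] {Ω γ : ι → Type} [∀ i, Fintype (Ω i)]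

open Classical in
theorem prob_pi (f : (i : ι) → Ω i → γ i) (x : (i : ι) → γ i) :
    prob (fun ω : (i : ι) → Ω i => fun i => f i (ω i)) x = ∏ i, prob (f i) (x i) := by
  unfold prob
  rw [Finset.prod_div_distrib, Fintype.card_pi]
  push_cast
  congr 1
  norm_cast
  rw [← Fintype.card_piFinset]
  congr 1
  ext ω
  simp [funext_iff]

theorem prob_comp_eval [∀ i, Nonempty (Ω i)] (i : ι) {δ : Type} (f : Ω i → δ) (x : δ) :
    prob (fun ω : (i : ι) → Ω i => f (ω i)) x = prob f x := by
  classical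
  -- `none` is a constant value for all coordinates other than `i`, which thus contribute factors
  -- equal to 1.
  have h := prob_pi (Ω := Ω) (γ := fun _ => Option δ)
    (fun j ω => if h : j = i then some (f (h ▸ ω)) else none)
    (fun j => if j = i then some x else none)
  rw [Finset.prod_eq_single i] at h
  · simp only [dite_true, if_true] at h
    convert h using 1
    · unfold prob
      congr 3
      ext ω
      simp only [mem_filter, mem_univ, true_and, funext_iff]
      constructor
      · intro hω j
        by_cases hj : j = i
        · subst hj; simp [hω]
        · simp [hj]
      · intro hω
        simpa using hω i
    · simp [prob]
  · intro j _ hj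
    simp [hj, prob]
  · simp

theorem natEntropy_pi [∀ i, Nonempty (Ω i)] (f : (i : ι) → Ω i → γ i) :
    natEntropy (fun ω : (i : ι) → Ω i => fun i => f i (ω i)) =
      ∑ i, natEntropy (fun ω : (i : ι) → Ω i => f i (ω i)) := by
  classical
  unfold natEntropy
  rw [← Finset.sum_div, Finset.sum_comm]
  congr 1
  refine Finset.sum_congr rfl fun ω _ => ?_
  rw [prob_pi, Real.log_prod fun i _ => (prob_apply_pos (f i) (ω i)).ne', Finset.sum_neg_distrib]
  simp [prob_comp_eval]

theorem natEntropy_eval [∀ i, Nonempty (Ω i)] (i : ι) :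
    natEntropy (fun ω : (i : ι) → Ω i => ω i) = Real.log (Fintype.card (Ω i)) := by
  refine natEntropy_eq_log_of_prob_eq _ fun ω => ?_
  rw [prob_comp_eval i (fun x => x), prob, Finset.card_eq_one.2 ⟨ω i, by ext; simp⟩, Nat.cast_one,
    one_div]

end Independence

end ADT

/-! ### Structure of a TIN optimal cyclic sub-channel. -/

namespace ADT

variable {K M : ℕ}

theorem shiftFloor_of_le {s l : ℕ} (x : Signal) (h : s ≤ l) : shiftFloor s x l = 0 :=
  if_neg h.not_gt

theorem shiftFloor_of_lt {s l : ℕ} (x : Signal) (h : l < s) :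
    shiftFloor s x l = x (s - 1 - l) := if_pos h

theorem shiftFloor_zero (x : Signal) : shiftFloor 0 x = 0 :=
  funext fun l => shiftFloor_of_le x l.zero_le

theorem output_apply (n : Strengths K) (x : Fin K → Signal) (k : Fin K) (l : ℕ) :
    output n x k l = ∑ i, shiftFloor (n k i) (x i) l := by
  rw [output, Finset.sum_apply]

/-- The strength of the strongest interference caused by user `i`. -/
def caused (n : Strengths K) (i : Fin K) : ℕ := (univ.erase i).sup fun k => n k i

theorem le_caused (n : Strengths K) {i k : Fin K} (h : k ≠ i) : n k i ≤ caused n i :=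
  Finset.le_sup (f := fun k => n k i) (mem_erase.2 ⟨h, mem_univ k⟩)

theorem exists_caused_eq (n : Strengths K) (i : Fin K) (h : caused n i ≠ 0) :
    ∃ k, k ≠ i ∧ n k i = caused n i := by
  have hne : (univ.erase i).Nonempty := by
    rw [Finset.nonempty_iff_ne_empty]
    intro h0
    simp [caused, h0] at h
  obtain ⟨k, hk, hk'⟩ := Finset.exists_mem_eq_sup _ hne fun k => n k i
  exact ⟨k, (mem_erase.1 hk).1, hk'.symm⟩

theorem TINOptimal.caused_le {n : Strengths K} (hn : TINOptimal n) (i : Fin K) :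
    caused n i ≤ n i i :=
  Finset.sup_le fun k hk => by
    have := hn i k k (mem_erase.1 hk).1 (mem_erase.1 hk).1
    omega

theorem TINOptimal.caused_add_le {n : Strengths K} (hn : TINOptimal n) {i j : Fin K}
    (h : j ≠ i) : caused n i + n i j ≤ n i i := by
  by_cases h0 : caused n i = 0
  · have := hn i j j h h
    omega
  · obtain ⟨k, hk, hk'⟩ := exists_caused_eq n i h0
    rw [← hk']
    exact hn i k j hk h

/-- What the converse needs from cyclicity: each receiver has at most one interferer, because the
predecessor map is injective. -/
theorem IsCyclic.eq_of_interferes {n : Strengths K} (hn : IsCyclic n) {i j j' : Fin K}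
    (hj : i ≠ j) (hj' : i ≠ j') (h : n i j ≠ 0) (h' : n i j' ≠ 0) : j = j' := by
  obtain ⟨S, π, -, hπ⟩ := hn
  exact π.injective ((hπ i j hj h).2.symm.trans (hπ i j' hj' h').2)

/-- The signal `x` of Transmitter `i` as interference at Receiver `k`. -/
def interference (n : Strengths K) (k i : Fin K) (x : Signal) : Signal :=
  if k = i then 0 else shiftFloor (n k i) x

theorem output_eq_add_sum_interference (n : Strengths K) (x : Fin K → Signal) (k : Fin K) :
    output n x k = shiftFloor (n k k) (x k) + ∑ i, interference n k i (x i) := by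
  unfold output
  rw [← Finset.add_sum_erase univ _ (mem_univ k), ← Finset.add_sum_erase univ
    (fun i => interference n k i (x i)) (mem_univ k)]
  simp only [interference, if_true, zero_add]
  congr 1
  refine Finset.sum_congr rfl fun i hi => ?_
  rw [if_neg (mem_erase.1 hi).1.symm]

/-- With at most one interferer at each receiver, the total interference determines its parts. -/
theorem IsCyclic.interference_eq {n : Strengths K} (hn : IsCyclic n) (k : Fin K)
    (x y : Fin K → Signal)
    (h : ∑ i, interference n k i (x i) = ∑ i, interference n k i (y i)) (j : Fin K) :
    interference n k j (x j) = interference n k j (y j) := by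
  by_cases hkj : k = j
  · simp [interference, hkj]
  by_cases h0 : n k j = 0
  · simp [interference, hkj, h0, shiftFloor_zero]
  have key : ∀ z : Fin K → Signal,
      ∑ i, interference n k i (z i) = interference n k j (z j) := fun z => by
    refine Finset.sum_eq_single j (fun i _ hij => ?_) (by simp)
    unfold interference
    split_ifs with hki
    · rfl
    · have : n k i = 0 := by
        by_contra hi
        exact hij (hn.eq_of_interferes hki hkj hi h0)
      rw [this, shiftFloor_zero]
  rw [← key, ← key, h]

/-- The number of levels at which Receiver `k`, but no other receiver, hears Transmitter `k`. -/
def privateLevels (n : Strengths K) (k : Fin K) : ℕ := n k k - caused n k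

/-- Above the private levels Receiver `k` hears only its own transmitter, and the bits heard there
are the first `caused n k` ones, which also reach the receiver that user `k` disturbs most. -/
theorem TINOptimal.output_eq {n : Strengths K} (hn : TINOptimal n) (k : Fin K)
    (x y : Fin K → Signal)
    (hS : ∀ i, interference n i k (x k) = interference n i k (y k))
    (hY : ∀ l < privateLevels n k, output n x k l = output n y k l) :
    output n x k = output n y k := by
  funext l
  by_cases hl : l < privateLevels n k
  · exact hY l hl
  have key : ∀ z : Fin K → Signal, output n z k l = shiftFloor (n k k) (z k) l := fun z => by
    rw [output_apply]
    refine Finset.sum_eq_single k (fun i _ hik => shiftFloor_of_le _ ?_) (by simp)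
    have := hn.caused_add_le hik
    unfold privateLevels at hl
    omega
  rw [key, key]
  by_cases hl' : n k k ≤ l
  · rw [shiftFloor_of_le _ hl', shiftFloor_of_le _ hl']
  have hc := hn.caused_le k
  unfold privateLevels at hl
  obtain ⟨i, hik, hi⟩ := exists_caused_eq n k (by omega)
  -- The input bit at level `l` of Receiver `k` appears at Receiver `i` lowered by `n k k - caused n
  -- k` levels.
  have h := congrFun (hS i) (l - (n k k - caused n k))
  simp only [interference, if_neg hik] at h
  rw [shiftFloor_of_lt _ (by omega), shiftFloor_of_lt _ (by omega), hi] at h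
  rw [shiftFloor_of_lt _ (by omega), shiftFloor_of_lt _ (by omega)]
  convert h using 2 <;> omega

theorem numMsg_pos (T : ℕ) (R : ℝ) : 0 < numMsg T R := Nat.ceil_pos.2 (by positivity)

instance (T : ℕ) (R : ℝ) : NeZero (numMsg T R) := ⟨(numMsg_pos T R).ne'⟩

/-! ### The entropy bound on the sum-rate. -/

section Converse

variable {T : ℕ} {R : Fin K → ℝ} (c : Code K M T R) (n : Fin M → Strengths K)

/-- The interference that the signal of Transmitter `i` causes at Receiver `k`. -/
def Code.interference (k i : Fin K) (w : (i : Fin K) → Fin (numMsg T (R i))) :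
    Fin T → Fin M → Signal :=
  fun t m => ADT.interference (n m) k i (c.enc i (w i) t m)

/-- The outputs of Receiver `k` at the levels at which Transmitter `k` interferes nowhere. -/
def Code.privateOutput (k : Fin K) (w : (i : Fin K) → Fin (numMsg T (R i))) :
    Fin T → (m : Fin M) → Fin (privateLevels (n m) k) → ZMod 2 :=
  fun t m l => c.observed n w k t m l

theorem Code.natEntropy_privateOutput_le (k : Fin K) :
    natEntropy (c.privateOutput n k) ≤ T * (∑ m, (privateLevels (n m) k : ℝ)) * Real.log 2 := by
  refine (natEntropy_le_log_card _).trans (le_of_eq ?_)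
  simp only [Fintype.card_pi, ZMod.card, Finset.prod_const, Finset.card_univ, Fintype.card_fin,
    Finset.prod_pow_eq_pow_sum]
  push_cast
  rw [Real.log_pow, Real.log_pow]
  push_cast
  ring

theorem Code.log_add_natEntropy_interference_le (hcyc : ∀ m, IsCyclic (n m)) (k : Fin K) :
    Real.log (numMsg T (R k)) + ∑ i, natEntropy (c.interference n k i) ≤
      natEntropy fun w => (w k, c.observed n w k) := by
  classical
  -- The second component carries the message of user `k` alone and is constant for the others, so
  -- one independent family holds both W_k and all the interference.
  have hind := natEntropy_pi (ι := Fin K) (Ω := fun i => Fin (numMsg T (R i)))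
    (γ := fun _ => (Fin T → Fin M → Signal) × ℕ)
    (fun i w => (fun t m => ADT.interference (n m) k i (c.enc i w t m),
      if i = k then (w : ℕ) else 0))
  have hle : Real.log (numMsg T (R k)) + ∑ i, natEntropy (c.interference n k i) ≤
      ∑ i, natEntropy fun w : (i : Fin K) → Fin (numMsg T (R i)) =>
        ((fun t m => ADT.interference (n m) k i (c.enc i (w i) t m) : Fin T → Fin M → Signal),
          if i = k then (w i : ℕ) else 0) := by
    rw [← Finset.add_sum_erase univ _ (mem_univ k), ← add_assoc,
      ← Finset.add_sum_erase univ _ (mem_univ k)]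
    refine add_le_add ?_ (Finset.sum_le_sum fun i _ => ?_)
    · have h0 : natEntropy (c.interference n k k) = 0 :=
        natEntropy_const _ fun w w' => by
          funext t m; simp [Code.interference, ADT.interference]
      have h1 := natEntropy_eval (Ω := fun i => Fin (numMsg T (R i))) k
      rw [Fintype.card_fin] at h1
      rw [h0, add_zero, ← h1]
      refine natEntropy_mono _ _ fun w w' h => ?_
      simpa [Fin.ext_iff] using (Prod.ext_iff.1 h).2
    · exact natEntropy_mono _ _ fun w w' h => (Prod.ext_iff.1 h).1
  rw [← hind] at hle
  refine hle.trans (natEntropy_mono _ _ fun w w' h => ?_)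
  obtain ⟨hk, hY⟩ := Prod.ext_iff.1 h
  simp only at hk hY
  funext i
  refine Prod.ext ?_ ?_
  · funext t m
    refine (hcyc m).interference_eq k (fun i => c.enc i (w i) t m) (fun i => c.enc i (w' i) t m)
      ?_ i
    -- Equal messages of user `k` give equal desired signals, which cancel and leave the total
    -- interference.
    have h1 := congrFun (congrFun hY t) m
    simp only [Code.observed, output_eq_add_sum_interference, hk] at h1
    exact add_left_cancel h1
  · dsimp only
    split_ifs with hik
    · subst hik; rw [hk]
    · rfl

theorem Code.natEntropy_observed_le (hTIN : ∀ m, TINOptimal (n m)) (k : Fin K) :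
    natEntropy (fun w => (w k, c.observed n w k)) ≤
      ∑ i, natEntropy (c.interference n i k) +
        T * (∑ m, (privateLevels (n m) k : ℝ)) * Real.log 2 + Real.log 2 +
        c.errorProb n k * Real.log (numMsg T (R k)) := by
  classical
  set Z := fun w : (i : Fin K) → Fin (numMsg T (R i)) =>
    ((fun i => c.interference n i k w : Fin K → Fin T → Fin M → Signal),
      c.privateOutput n k w) with hZ
  have hdet : ∀ w w', Z w = Z w' → c.observed n w k = c.observed n w' k := fun w w' h => by
    obtain ⟨hS, hY⟩ := Prod.ext_iff.1 h
    funext t m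
    refine (hTIN m).output_eq k _ _ (fun i => ?_) fun l hl => ?_
    · exact congrFun (congrFun (congrFun hS i) t) m
    · exact congrFun (congrFun (congrFun hY t) m) ⟨l, hl⟩
  have hfact : (fun w => c.observed n w k).FactorsThrough Z := fun w w' h => hdet w w' h
  -- Reconstructing the output from `Z` by `g` makes the decoder an estimator based on `Z`, with
  -- unchanged error probability.
  obtain ⟨g, hg⟩ := (Function.factorsThrough_iff _).1 hfact
  have hFano := natEntropy_prod_le_of_estimate
    (fun w : (i : Fin K) → Fin (numMsg T (R i)) => w k) Z (fun z => c.dec k (g z))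
  have herr : (#{w : (i : Fin K) → Fin (numMsg T (R i)) | c.dec k (g (Z w)) ≠ w k} : ℝ) /
      (Fintype.card ((i : Fin K) → Fin (numMsg T (R i))) : ℝ) = c.errorProb n k := by
    have hg' : ∀ w, g (Z w) = c.observed n w k := fun w => (congrFun hg w).symm
    unfold Code.errorProb
    simp only [hg']
  rw [Fintype.card_fin] at hFano
  have hmono : natEntropy (fun w => (w k, c.observed n w k)) ≤
      natEntropy fun w => (w k, Z w) :=
    natEntropy_mono _ _ fun w w' h =>
      Prod.ext (Prod.ext_iff.1 h).1 (hdet w w' (Prod.ext_iff.1 h).2)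
  have h1 := natEntropy_prod_le
    (fun w => (fun i => c.interference n i k w : Fin K → Fin T → Fin M → Signal))
    (c.privateOutput n k)
  have h2 := natEntropy_pi_le fun i => c.interference n i k
  have h3 := c.natEntropy_privateOutput_le n k
  have herr' : (#{w : (i : Fin K) → Fin (numMsg T (R i)) | c.dec k (g (Z w)) ≠ w k} : ℝ) /
      (Fintype.card ((i : Fin K) → Fin (numMsg T (R i))) : ℝ) *
        Real.log (numMsg T (R k)) = c.errorProb n k * Real.log (numMsg T (R k)) := by rw [herr]
  have hFano' : natEntropy (fun w => (w k, Z w)) ≤ natEntropy Z + Real.log 2 +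
      c.errorProb n k * Real.log (numMsg T (R k)) := by
    rw [← herr']
    convert hFano
  linarith

theorem Code.errorProb_le_one (k : Fin K) : c.errorProb n k ≤ 1 := by
  unfold Code.errorProb
  refine div_le_one_of_le₀ ?_ (by positivity)
  exact_mod_cast Finset.card_le_univ _

theorem Code.sum_rate_mul_le (hTIN : ∀ m, TINOptimal (n m)) (hcyc : ∀ m, IsCyclic (n m)) :
    T * ∑ k, R k * (1 - c.errorProb n k) ≤ T * ∑ k, ∑ m, (privateLevels (n m) k : ℝ) + K := by
  have hlog : ∀ k, T * R k * Real.log 2 ≤ Real.log (numMsg T (R k)) := fun k => by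
    rw [← Real.log_rpow two_pos]
    exact Real.log_le_log (by positivity) (Nat.le_ceil _)
  have h := Finset.sum_le_sum fun k (_ : k ∈ univ) =>
    (c.log_add_natEntropy_interference_le n hcyc k).trans (c.natEntropy_observed_le n hTIN k)
  have h' : ∑ k, T * R k * Real.log 2 * (1 - c.errorProb n k) ≤
      ∑ k, Real.log (numMsg T (R k)) * (1 - c.errorProb n k) :=
    Finset.sum_le_sum fun k _ =>
      mul_le_mul_of_nonneg_right (hlog k) (sub_nonneg.2 (c.errorProb_le_one n k))
  simp only [Finset.sum_add_distrib, ← Finset.sum_mul, ← Finset.mul_sum, sum_const, card_univ,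
    Fintype.card_fin, nsmul_eq_mul] at h
  -- Exchanging the sums makes the interference entropies caused equal to those suffered, so they
  -- cancel.
  rw [Finset.sum_comm (f := fun k i => natEntropy (c.interference n i k))] at h
  have h2 : ∑ k, Real.log (numMsg T (R k)) * (1 - c.errorProb n k) =
      ∑ k, Real.log (numMsg T (R k)) - ∑ k, c.errorProb n k * Real.log (numMsg T (R k)) := by
    rw [← Finset.sum_sub_distrib]
    exact Finset.sum_congr rfl fun k _ => by ring
  have h3 : ∑ k, T * R k * Real.log 2 * (1 - c.errorProb n k) =
      (T * ∑ k, R k * (1 - c.errorProb n k)) * Real.log 2 := by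
    rw [Finset.mul_sum, Finset.sum_mul]
    exact Finset.sum_congr rfl fun k _ => by ring
  refine le_of_mul_le_mul_right ?_ (Real.log_pos one_lt_two)
  linarith

end Converse

theorem Achievable.sum_le {n : Fin M → Strengths K} {R : Fin K → ℝ} (hR : Achievable n R)
    (hTIN : ∀ m, TINOptimal (n m)) (hcyc : ∀ m, IsCyclic (n m)) :
    ∑ k, R k ≤ ∑ k, ∑ m, (privateLevels (n m) k : ℝ) := by
  obtain ⟨-, c, hc⟩ := hR
  have hl : Tendsto (fun T => ∑ k, R k * (1 - (c T).errorProb n k)) atTop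
      (𝓝 (∑ k, R k * (1 - 0))) :=
    tendsto_finsetSum _ fun k _ => (tendsto_const_nhds.sub (hc k)).const_mul _
  have hr : Tendsto (fun T : ℕ => ∑ k, ∑ m, (privateLevels (n m) k : ℝ) + (K : ℝ) / T) atTop
      (𝓝 (∑ k, ∑ m, (privateLevels (n m) k : ℝ) + 0)) :=
    (tendsto_const_div_atTop_nhds_zero_nat _).const_add _
  simp only [sub_zero, mul_one, add_zero] at hl hr
  refine le_of_tendsto_of_tendsto hl hr ?_
  filter_upwards [eventually_gt_atTop 0] with T hT
  have hT' : (0 : ℝ) < T := by exact_mod_cast hT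
  have h := (c T).sum_rate_mul_le n hTIN hcyc
  refine le_of_mul_le_mul_left (h.trans_eq ?_) hT'
  field_simp

theorem sum_le_of_mem_capacityRegion {n : Fin M → Strengths K} {R : Fin K → ℝ}
    (hR : R ∈ capacityRegion n) (hTIN : ∀ m, TINOptimal (n m)) (hcyc : ∀ m, IsCyclic (n m)) :
    ∑ k, R k ≤ ∑ k, ∑ m, (privateLevels (n m) k : ℝ) :=
  closure_minimal (t := {R : Fin K → ℝ | ∑ k, R k ≤ ∑ k, ∑ m, (privateLevels (n m) k : ℝ)})
    (fun _ h => Achievable.sum_le h hTIN hcyc)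
    (isClosed_le (by fun_prop) continuous_const) hR

end ADT

/-! ### Achievability by making all interference inaudible. -/

namespace ADT

variable {K M : ℕ}

theorem output_eq_of_inaudible {n : Strengths K} {x : Fin K → Signal}
    (hx : ∀ i, ∀ l < caused n i, x i l = 0) (k : Fin K) :
    output n x k = shiftFloor (n k k) (x k) := by
  rw [output_eq_add_sum_interference, add_eq_left]
  refine Finset.sum_eq_zero fun i _ => ?_
  unfold interference
  split_ifs with h
  · rfl
  · funext l
    have := le_caused n h
    by_cases hl : l < n k i
    · rw [shiftFloor_of_lt _ hl, hx i _ (by omega), Pi.zero_apply]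
    · exact shiftFloor_of_le _ (not_lt.1 hl)

theorem le_maxLevel (n : Strengths K) (k i : Fin K) : n k i ≤ maxLevel n :=
  (Finset.le_sup (f := fun i => n k i) (mem_univ i)).trans
    (Finset.le_sup (f := fun k => univ.sup fun i => n k i) (mem_univ k))

theorem powerControlled_of_lt {q p l : ℕ} (b : Fin q → ZMod 2) (h : l < p) :
    powerControlled p b l = 0 := by
  unfold powerControlled
  split_ifs <;> first | rfl | omega

theorem powerControlled_of_le {q p l : ℕ} (b : Fin q → ZMod 2) (h : p ≤ l) (hl : l < q) :
    powerControlled p b l = b ⟨l, hl⟩ := by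
  rw [powerControlled, dif_pos hl, if_pos h]

/-- With inaudible interference, the TIN rate is the number of private levels. -/
theorem tinRate_caused (n : Strengths K) (k : Fin K) :
    tinRate n (caused n) k = privateLevels n k := by
  have hout : ∀ b : Fin K → Fin (maxLevel n) → ZMod 2,
      output n (fun i => powerControlled (caused n i) (b i)) k =
        shiftFloor (n k k) (powerControlled (caused n k) (b k)) := fun b =>
    output_eq_of_inaudible (fun i l hl => powerControlled_of_lt _ hl) k
  have hlt : ∀ a : Fin (privateLevels n k), caused n k + a < maxLevel n := fun a => by
    have h1 := a.2
    have h2 := le_maxLevel n k k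
    unfold privateLevels at h1
    omega
  -- The private bits of user `k` carry the same information as the output and form a surjective
  -- homomorphic image of the fair bits, hence are uniform.
  let f : (Fin K → Fin (maxLevel n) → ZMod 2) →+ (Fin (privateLevels n k) → ZMod 2) :=
    { toFun := fun b a => b k ⟨caused n k + a, hlt a⟩
      map_zero' := rfl
      map_add' := fun _ _ => rfl }
  have hf : Function.Surjective f := fun v => by
    refine ⟨fun _ l => if h : caused n k ≤ l ∧ l - caused n k < privateLevels n k then
      v ⟨l - caused n k, h.2⟩ else 0, ?_⟩
    funext a
    simp [f]
  have hY : natEntropy (fun b : Fin K → Fin (maxLevel n) → ZMod 2 =>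
      output n (fun i => powerControlled (caused n i) (b i)) k) =
        privateLevels n k * Real.log 2 := by
    rw [natEntropy_congr _ f, natEntropy_of_additive f hf]
    · simp [Fintype.card_pi, ZMod.card, Real.log_pow]
    · intro b b'
      rw [hout, hout]
      constructor
      · intro h
        funext a
        have ha := a.2
        unfold privateLevels at ha
        have := congrFun h (n k k - 1 - (caused n k + a))
        rw [shiftFloor_of_lt _ (by omega), shiftFloor_of_lt _ (by omega),
          show n k k - 1 - (n k k - 1 - (caused n k + a)) = caused n k + a by omega,
          powerControlled_of_le _ (by omega) (hlt a),
          powerControlled_of_le _ (by omega) (hlt a)] at this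
        exact this
      · intro h
        funext l
        by_cases hl : l < n k k
        · rw [shiftFloor_of_lt _ hl, shiftFloor_of_lt _ hl]
          by_cases hc : n k k - 1 - l < caused n k
          · rw [powerControlled_of_lt _ hc, powerControlled_of_lt _ hc]
          · have h2 := le_maxLevel n k k
            have := congrFun h ⟨n k k - 1 - l - caused n k, by unfold privateLevels; omega⟩
            rw [powerControlled_of_le _ (by omega) (by omega),
              powerControlled_of_le _ (by omega) (by omega)]
            simp only [f, AddMonoidHom.coe_mk, ZeroHom.coe_mk] at this
            convert this using 3 <;> omega
        · rw [shiftFloor_of_le _ (not_lt.1 hl), shiftFloor_of_le _ (not_lt.1 hl)]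
  unfold tinRate mutualInfo
  simp only [entropy_eq_natEntropy_div]
  -- Without interference the output is a function of the input, so H(X, Y) = H(X) and the rate is
  -- H(Y).
  rw [hY, natEntropy_congr (fun b => (powerControlled (caused n k) (b k),
    output n (fun i => powerControlled (caused n i) (b i)) k))
    (fun b : Fin K → Fin (maxLevel n) → ZMod 2 => powerControlled (caused n k) (b k))]
  · have := (Real.log_pos one_lt_two).ne'
    field_simp
    ring
  · intro b b'
    simp only [hout, Prod.mk.injEq, and_iff_left_iff_imp]
    intro h
    rw [h]

/-- At integer rates the ceiling is exact, so messages correspond bijectively to bit blocks. -/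
theorem numMsg_natCast (T N : ℕ) : numMsg T N = 2 ^ (T * N) := by
  unfold numMsg
  rw [← Nat.cast_mul, Real.rpow_natCast]
  exact_mod_cast Nat.ceil_natCast (R := ℝ) (2 ^ (T * N))

/-- The messages of user `i` as blocks of bits for its private levels. -/
noncomputable def messageEquiv (n : Fin M → Strengths K) (T : ℕ) (i : Fin K) :
    Fin (numMsg T (∑ m, (privateLevels (n m) i : ℝ))) ≃
      (Fin T → (m : Fin M) → Fin (privateLevels (n m) i) → ZMod 2) :=
  Fintype.equivOfCardEq <| by
    rw [← Nat.cast_sum, numMsg_natCast]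
    simp [Fintype.card_pi, ZMod.card, Finset.prod_pow_eq_pow_sum, ← pow_mul, mul_comm]

/-- The uncoded transmission of the message bits on the private levels. -/
noncomputable def privateCode (n : Fin M → Strengths K) (T : ℕ) :
    Code K M T (fun i => ∑ m, (privateLevels (n m) i : ℝ)) where
  enc i w t m l :=
    if h : caused (n m) i ≤ l ∧ l - caused (n m) i < privateLevels (n m) i then
      messageEquiv n T i w t m ⟨l - caused (n m) i, h.2⟩ else 0
  -- Private bit `a` is input bit `caused + a`, received at level `n k k - 1 - (caused + a)`.
  dec k y := (messageEquiv n T k).symm fun t m a => y t m (privateLevels (n m) k - 1 - a)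

theorem privateCode_errorProb (n : Fin M → Strengths K) (T : ℕ) (k : Fin K) :
    (privateCode n T).errorProb n k = 0 := by
  have h : ∀ w, (privateCode n T).dec k ((privateCode n T).observed n w k) = w k := by
    intro w
    refine (messageEquiv n T k).symm_apply_eq.2 ?_
    funext t m a
    have ha := a.2
    simp only [Code.observed]
    rw [output_eq_of_inaudible, shiftFloor_of_lt]
    · simp only [privateCode]
      unfold privateLevels at ha
      rw [dif_pos]
      · refine congrArg (messageEquiv n T k (w k) t m) (Fin.ext ?_)
        simp only [privateLevels]
        omega
      · unfold privateLevels
        omega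
    · unfold privateLevels at ha ⊢
      omega
    · intro i l hl
      exact dif_neg fun h => by omega
  unfold Code.errorProb
  simp [h]

theorem achievable_privateLevels (n : Fin M → Strengths K) :
    Achievable n fun i => ∑ m, (privateLevels (n m) i : ℝ) :=
  ⟨fun _ => by positivity, privateCode n, fun k => by simp [privateCode_errorProb]⟩

theorem isSumCapacity_privateLevels (n : Fin M → Strengths K)
    (hTIN : ∀ m, TINOptimal (n m)) (hcyc : ∀ m, IsCyclic (n m)) :
    IsSumCapacity n (∑ i, ∑ m, (privateLevels (n m) i : ℝ)) :=
  ⟨⟨_, subset_closure (achievable_privateLevels n), rfl⟩, by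
    rintro _ ⟨R, hR, rfl⟩
    exact sum_le_of_mem_capacityRegion hR hTIN hcyc⟩

end ADT

/-- If each sub-channel of a parallel ADT deterministic interference network is TIN optimal and a
cyclic interference network, then separate TIN achieves the sum-capacity: for suitable power control on each
sub-channel, the TIN rates are achievable over each sub-channel alone and attain its sum-capacity,
and their sums over the sub-channels are achievable in the parallel network and attain its
sum-capacity. -/
theorem corollary2 {K M : ℕ} (n : Fin M → ADT.Strengths K)
    (hTIN : ∀ m, ADT.TINOptimal (n m)) (hcyc : ∀ m, ADT.IsCyclic (n m)) :
    ∃ p : Fin M → Fin K → ℕ,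
      (∀ m, ADT.tinRate (n m) (p m) ∈ ADT.capacityRegion (ADT.single (n m)) ∧
        ADT.IsSumCapacity (ADT.single (n m)) (∑ i, ADT.tinRate (n m) (p m) i)) ∧
      (fun i => ∑ m, ADT.tinRate (n m) (p m) i) ∈ ADT.capacityRegion n ∧
      ADT.IsSumCapacity n (∑ i, ∑ m, ADT.tinRate (n m) (p m) i) := by
  -- The least back-off that makes each transmitter inaudible at all other receivers.
  refine ⟨fun m => ADT.caused (n m), fun m => ?_, ?_⟩
  · have hrate : ADT.tinRate (n m) (ADT.caused (n m)) =
        fun i => (ADT.privateLevels (n m) i : ℝ) := funext (ADT.tinRate_caused (n m))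
    have h1 := ADT.achievable_privateLevels (ADT.single (n m))
    have h2 := ADT.isSumCapacity_privateLevels (ADT.single (n m)) (fun _ => hTIN m)
      fun _ => hcyc m
    simp only [ADT.single, univ_unique, sum_const, card_singleton, one_smul] at h1 h2
    rw [hrate]
    exact ⟨subset_closure h1, h2⟩
  · simp only [ADT.tinRate_caused]
    exact ⟨subset_closure (ADT.achievable_privateLevels n),
      ADT.isSumCapacity_privateLevels n hTIN hcyc⟩
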